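/- Let $q\in(0,1)$ and let $L\ge 0$ be a fixed integer. Write $(q;q)_n=\prod_{k=1}^{n}(1-q^k)$, $(q;q)_\infty=\prod_{k\ge1}(1-q^k)$, and let $$S_n(x)=(-1)^n q^{-n^2-n/2}\sum_{k=0}^n \frac{(q;q)_n}{(q;q)_k(q;q)_{n-k}}\,q^{k^2+k/2}(-x)^k$$ be the monic Stieltjes–Wigert polynomials. For integers $N\ge 0$ put $\lambda=-q^{-N-L/2}$ and $$\widehat Z_{L\times N}=\frac{(-1)^{LN}}{\prod_{j=0}^{L-1}j!}\,\det\bigl(S_{N+j}^{(i)}(\lambda)\bigr)_{0\le i,j\le L-1},$$ where $S_{n}^{(i)}$ is the $i$-th derivative (determinants of size $0$ and empty products equal $1$). Let $\Theta(z)=\sum_{k=-\infty}^{\infty}q^{k^2}z^k$ and $\Theta_j(z)=z^j\Theta^{(j)}(z)$ for $z>0$, let $\alpha=\alpha(N)=2\lfloor N/2\rfloor-N$, and let $R=R(N)$ be the $L\times L$ matrix with entries $$R_{ij}=\Theta_i\bigl(q^{\alpha-j-\frac{L-1}{2}}\bigr),\qquad 0\le i,j\le L-1.$$ Then, with $(a)_i=a(a+1)\cdots(a+i-1)$,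 $$R_{ij}=\sum_{k=-\infty}^{\infty}q^{k^2}q^{k\left(\alpha-j-\frac{L-1}{2}\right)}(-k)_i(-1)^i ,$$ the series being absolutely convergent, and, as $N\to\infty$, $$q^{\frac{5LN^2}{4}+\frac{L^2N}{2}}\,\widehat Z_{L\times N}\;\sim\;\frac{q^{\frac{L(L-\alpha-1)^2}{4}}}{(q;q)_\infty^L\prod_{j=0}^{L-1}j!}\,\det(R),$$ where $a(N)\sim b(N)$ means $\lim_{N\to\infty}a(N)/b(N)=1$. -/

import Mathlib

open Filter Topology Polynomial

namespace SWWronskian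

noncomputable section

/-- The `q`-shifted factorial `(a; q)_n = ∏_{k < n} (1 - a q^k)`. -/
def qPoch (a q : ℝ) (n : ℕ) : ℝ := ∏ k ∈ Finset.range n, (1 - a * q ^ k)

/-- The infinite `q`-shifted factorial `(a; q)_∞ = ∏_{k ≥ 0} (1 - a q^k)`; the product converges
absolutely for `|q| < 1`. -/
def qPochInf (a q : ℝ) : ℝ := ∏' k : ℕ, (1 - a * q ^ k)

/-- The Gaussian binomial coefficient `(q; q)_n / ((q; q)_k (q; q)_{n-k})`, used for `k ≤ n`. -/
def gaussBinom (q : ℝ) (n k : ℕ) : ℝ := qPoch q q n / (qPoch q q k * qPoch q q (n - k))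

/-- The monic Stieltjes-Wigert polynomial
`S_n(x) = (-1)^n q^{-n² - n/2} ∑_{k=0}^n [n choose k]_q q^{k² + k/2} (-x)^k`. -/
def stieltjesWigert (q : ℝ) (n : ℕ) : ℝ[X] :=
  C ((-1) ^ n * q ^ (-(n : ℝ) ^ 2 - (n : ℝ) / 2)) *
    ∑ k ∈ Finset.range (n + 1),
      C (gaussBinom q n k * q ^ ((k : ℝ) ^ 2 + (k : ℝ) / 2)) * (-X) ^ k

/-- The spectral parameter `-q^{-N - L/2}`. -/
def spectralParam (q : ℝ) (L N : ℕ) : ℝ := -q ^ (-(N : ℝ) - (L : ℝ) / 2)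

/-- The Wronskian matrix: row `i`, column `j` is `S_{N+j}^{(i)}` at the spectral parameter. -/
def wronskianMatrix (q : ℝ) (L N : ℕ) : Matrix (Fin L) (Fin L) ℝ :=
  Matrix.of fun i j =>
    (derivative^[(i : ℕ)] (stieltjesWigert q (N + (j : ℕ)))).eval (spectralParam q L N)

/-- The normalized partition function
`Ẑ_{L×N} = (-1)^{LN} / ∏_{j<L} j! · det (S_{N+j}^{(i)}(λ))_{0 ≤ i, j < L}`. -/
def Zhat (q : ℝ) (L N : ℕ) : ℝ :=
  (-1) ^ (L * N) / (∏ j ∈ Finset.range L, (j.factorial : ℝ)) * (wronskianMatrix q L N).det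

/-- The theta function `Θ(z) = ∑_{k ∈ ℤ} q^{k²} z^k`. -/
def theta (q z : ℝ) : ℝ := ∑' k : ℤ, q ^ (k ^ 2) * z ^ k

/-- `Θ_j(z) = z^j Θ^{(j)}(z)`. -/
def thetaD (q : ℝ) (j : ℕ) (z : ℝ) : ℝ := z ^ j * iteratedDeriv j (theta q) z

/-- `α = 2 ⌊N/2⌋ - N`, an integer that may be negative. -/
def alpha (N : ℕ) : ℤ := 2 * ((N / 2 : ℕ) : ℤ) - (N : ℤ)

/-- The matrix `R_{ij} = Θ_i(q^{α - j - (L-1)/2})`, `0 ≤ i, j < L`. -/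
def matrixR (q : ℝ) (L N : ℕ) : Matrix (Fin L) (Fin L) ℝ :=
  Matrix.of fun i j =>
    thetaD q (i : ℕ) (q ^ ((alpha N : ℝ) - ((j : ℕ) : ℝ) - ((L : ℝ) - 1) / 2))

end

end SWWronskian

/-! Each Wronskian entry is a sum over `k` of a Gaussian binomial, a falling factorial and a
Gaussian weight. Centring at `k = ⌊N/2⌋ + m` turns the weight into a constant times `q^(m²) z^m`,
with `z = q^(α-(L-1)/2)`. Translating the falling factorials is a unitriangular row operation;
expanding `[N+j choose k]` by `q`-Vandermonde is a triangular column operation, whose factor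
`q^(-lm)` replaces `z` by `z q^(-l)`. Hence the Wronskian is exactly an explicit diagonal product
times `det (coreMatrix q z L N)`.

Central Gaussian binomials tend to `1/(q;q)_∞` and are uniformly bounded, so for fixed `z` dominated
convergence gives `(q;q)_∞^(-L)` times a moment determinant, which is `det R` once `Θ` is
differentiated termwise (`tendsto_det_coreMatrix`, `matrixR_eq`).

Division by `det R` is justified by `det_gaussianMoment_ne_zero`: a row dependence yields a
polynomial `P` of degree `< L` orthogonal to every `q^(-jk)`, `j < L`; pairing it with a `Q(q^(-k))`
having matching sign changes forces `P` to vanish at all integers. -/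

namespace SWWronskian

/-! ### Gaussian moments and derivatives of the theta function -/

/-- Polynomial moments of the discrete Gaussian weight `q^{k²} z^k` converge absolutely. -/
theorem summable_gaussian_mul_eval {q z : ℝ} (hq0 : 0 < q) (hq1 : q < 1) (hz : 0 < z)
    (P : ℝ[X]) : Summable fun k : ℤ => q ^ (k ^ 2) * P.eval (k : ℝ) * z ^ k := by
  -- `-log q / π` plays the role of `Im τ` in the Jacobi theta bound.
  have hlog : 0 < -Real.log q / Real.pi :=
    div_pos (neg_pos.2 (Real.log_neg hq0 hq1)) Real.pi_pos
  have key : ∀ n : ℕ, Summable fun k : ℤ => q ^ (k ^ 2) * (k : ℝ) ^ n * z ^ k := by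
    intro n
    refine (summable_pow_mul_jacobiTheta₂_term_bound
      (|Real.log z| / (2 * Real.pi)) hlog n).of_norm_bounded fun k => ?_
    have h1 : q ^ (k ^ 2) = Real.exp (Real.log q * (k : ℝ) ^ 2) := by
      rw [← Real.rpow_intCast, Real.rpow_def_of_pos hq0]; push_cast; rfl
    have h2 : z ^ k = Real.exp (Real.log z * (k : ℝ)) := by
      rw [← Real.rpow_intCast, Real.rpow_def_of_pos hz]
    have h3 : Real.log z * (k : ℝ) ≤ |Real.log z| * |(k : ℝ)| := by
      rw [← abs_mul]; exact le_abs_self _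
    rw [norm_mul, norm_mul, Real.norm_eq_abs, Real.norm_eq_abs, Real.norm_eq_abs, abs_pow, h1, h2,
      Real.abs_exp, Real.abs_exp, mul_comm (Real.exp _), mul_assoc, ← Real.exp_add]
    rw [← Int.cast_abs]
    refine mul_le_mul_of_nonneg_left (Real.exp_le_exp.2 ?_) (by positivity)
    rw [Int.cast_abs]
    have hpi := Real.pi_pos.ne'
    have : -Real.pi * (-Real.log q / Real.pi * (k : ℝ) ^ 2
        - 2 * (|Real.log z| / (2 * Real.pi)) * |(k : ℝ)|)
        = Real.log q * (k : ℝ) ^ 2 + |Real.log z| * |(k : ℝ)| := by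
      field_simp; ring
    rw [this]; linarith
  induction P using Polynomial.induction_on' with
  | add p r hp hr =>
    refine (hp.add hr).congr fun k => ?_
    rw [eval_add]; ring
  | monomial n a =>
    refine ((key n).mul_left a).congr fun k => ?_
    rw [eval_monomial]; ring

/-- `∑_k q^{k²} P(k) z^k`. -/
noncomputable def gaussianMoment (q z : ℝ) (P : ℝ[X]) : ℝ :=
  ∑' k : ℤ, q ^ (k ^ 2) * P.eval (k : ℝ) * z ^ k

/-- Powers are monotone or antitone in the base according to the sign of `n`; the sum of endpoint
values covers both cases and gives a majorant uniform in `y`. -/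
theorem zpow_le_add_zpow {a b y : ℝ} (ha : 0 < a) (hay : a ≤ y) (hyb : y ≤ b) (n : ℤ) :
    y ^ n ≤ a ^ n + b ^ n := by
  have hy : 0 < y := ha.trans_le hay
  have hb : 0 < b := hy.trans_le hyb
  rcases le_total 0 n with hn | hn
  · have := zpow_le_zpow_left₀ hn hy.le hyb
    have := zpow_pos ha n
    linarith
  · have h1 : y ^ n ≤ a ^ n := by
      have h2 := zpow_le_zpow_left₀ (neg_nonneg.2 hn) ha.le hay
      rw [zpow_neg, zpow_neg] at h2
      exact (inv_le_inv₀ (zpow_pos ha n) (zpow_pos hy n)).1 h2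
    have := zpow_pos hb n
    linarith

/-- Termwise differentiation of a Laurent series on the positive half-line. -/
theorem hasDerivAt_tsum_zpow {c : ℤ → ℝ} (s : ℤ) {z : ℝ} (hz : 0 < z)
    (h0 : ∀ x : ℝ, 0 < x → Summable fun k : ℤ => c k * x ^ (k - s))
    (h1 : ∀ x : ℝ, 0 < x → Summable fun k : ℤ => c k * ((k : ℝ) - s) * x ^ (k - s - 1)) :
    HasDerivAt (fun y => ∑' k : ℤ, c k * y ^ (k - s))
      (∑' k : ℤ, c k * ((k : ℝ) - s) * z ^ (k - s - 1)) z := by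
  have ha : 0 < z / 2 := by positivity
  have hb : 0 < 2 * z := by positivity
  have hmem : z ∈ Set.Ioo (z / 2) (2 * z) := ⟨by linarith, by linarith⟩
  refine hasDerivAt_tsum_of_isPreconnected (g := fun (k : ℤ) (y : ℝ) => c k * y ^ (k - s))
    (g' := fun (k : ℤ) (y : ℝ) => c k * ((k : ℝ) - s) * y ^ (k - s - 1))
    ((h1 _ ha).norm.add (h1 _ hb).norm) isOpen_Ioo isPreconnected_Ioo
    (fun k y hy => ?_) (fun k y hy => ?_) hmem (h0 z hz) hmem
  · have hy0 : y ≠ 0 := (ha.trans hy.1).ne'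
    have h := (hasDerivAt_zpow (k - s) y (Or.inl hy0)).const_mul (c k)
    rw [Int.cast_sub, ← mul_assoc] at h
    exact h
  · have hy0 : 0 < y := ha.trans hy.1
    simp only [norm_mul (c k * _), ← mul_add]
    refine mul_le_mul_of_nonneg_left ?_ (norm_nonneg _)
    rw [Real.norm_of_nonneg (zpow_pos hy0 _).le, Real.norm_of_nonneg (zpow_pos ha _).le,
      Real.norm_of_nonneg (zpow_pos hb _).le]
    exact zpow_le_add_zpow ha hy.1.le hy.2.le _

/-- Differentiating `y^(k-i)` produces the factor `k - i`, precisely the one that extends the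
falling factorial. -/
theorem hasDerivAt_theta_series {q z : ℝ} (hq0 : 0 < q) (hq1 : q < 1) (hz : 0 < z) (i : ℕ) :
    HasDerivAt
      (fun y => ∑' k : ℤ, q ^ (k ^ 2) * (descPochhammer ℝ i).eval (k : ℝ) * y ^ (k - (i : ℤ)))
      (∑' k : ℤ, q ^ (k ^ 2) * (descPochhammer ℝ (i + 1)).eval (k : ℝ) *
        z ^ (k - ((i + 1 : ℕ) : ℤ))) z := by
  have hsum : ∀ (j : ℕ) (x : ℝ), 0 < x → Summable fun k : ℤ =>
      q ^ (k ^ 2) * (descPochhammer ℝ j).eval (k : ℝ) * x ^ (k - (j : ℤ)) := fun j x hx => by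
    refine ((summable_gaussian_mul_eval hq0 hq1 hx (descPochhammer ℝ j)).mul_right
      (x ^ (-(j : ℤ)))).congr fun k => ?_
    rw [sub_eq_add_neg, zpow_add₀ hx.ne']; ring
  have hterm : ∀ (x : ℝ) (k : ℤ), q ^ (k ^ 2) * (descPochhammer ℝ (i + 1)).eval (k : ℝ) *
        x ^ (k - ((i + 1 : ℕ) : ℤ)) = q ^ (k ^ 2) * (descPochhammer ℝ i).eval (k : ℝ) *
        ((k : ℝ) - ((i : ℤ) : ℝ)) * x ^ (k - (i : ℤ) - 1) := fun x k => by
    rw [descPochhammer_succ_eval, sub_sub, Nat.cast_succ, Int.cast_natCast]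
    ring
  have h := hasDerivAt_tsum_zpow (c := fun k => q ^ (k ^ 2) * (descPochhammer ℝ i).eval (k : ℝ))
    (i : ℤ) hz (hsum i) fun x hx => (hsum (i + 1) x hx).congr (hterm x)
  rw [tsum_congr (hterm z)]
  exact h

theorem iteratedDeriv_theta {q z : ℝ} (hq0 : 0 < q) (hq1 : q < 1) (hz : 0 < z) (i : ℕ) :
    iteratedDeriv i (theta q) z =
      ∑' k : ℤ, q ^ (k ^ 2) * (descPochhammer ℝ i).eval (k : ℝ) * z ^ (k - (i : ℤ)) := by
  induction i generalizing z with
  | zero => simp [theta]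
  | succ i ih =>
    rw [iteratedDeriv_succ]
    have : iteratedDeriv i (theta q) =ᶠ[𝓝 z]
        fun y => ∑' k : ℤ, q ^ (k ^ 2) * (descPochhammer ℝ i).eval (k : ℝ) * y ^ (k - (i : ℤ)) := by
      filter_upwards [lt_mem_nhds hz] with y hy using ih hy
    rw [this.deriv_eq]
    exact (hasDerivAt_theta_series hq0 hq1 hz i).deriv

theorem thetaD_eq_gaussianMoment {q z : ℝ} (hq0 : 0 < q) (hq1 : q < 1) (hz : 0 < z) (i : ℕ) :
    thetaD q i z = gaussianMoment q z (descPochhammer ℝ i) := by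
  rw [thetaD, iteratedDeriv_theta hq0 hq1 hz, ← tsum_mul_left, gaussianMoment]
  refine tsum_congr fun k => ?_
  rw [zpow_sub₀ hz.ne', zpow_natCast]
  field_simp

/-! ### Nonvanishing of the moment determinant -/

/-- Linear combinations of falling factorials of degree `< L` vanish only trivially. -/
theorem sum_descPochhammer_ne_zero {L : ℕ} {v : Fin L → ℝ} (hv : v ≠ 0) :
    ∑ i, C (v i) * descPochhammer ℝ (i : ℕ) ≠ 0 := by
  intro h
  apply hv
  have key : ∀ n : ℕ, ∀ hn : n < L, v ⟨n, hn⟩ = 0 := by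
    intro n
    induction n using Nat.strong_induction_on with
    | _ n ih =>
      intro hn
      -- At `x = n` the terms with `i > n` vanish and those with `i < n` are zero by induction,
      -- leaving `v n * n!`.
      have h1 := congrArg (eval (n : ℝ)) h
      rw [eval_finsetSum, Finset.sum_eq_single (⟨n, hn⟩ : Fin L)] at h1
      · rw [eval_mul, eval_C, eval_zero, descPochhammer_eval_eq_descFactorial,
          Nat.descFactorial_self] at h1
        exact (mul_eq_zero.1 h1).resolve_right (by positivity)
      · intro i _ hi
        rcases lt_or_gt_of_ne (fun e => hi (Fin.ext e) : (i : ℕ) ≠ n) with hlt | hgt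
        · have := ih i hlt i.2
          simp [this]
        · rw [eval_mul, descPochhammer_eval_coe_nat_of_lt hgt, mul_zero]
      · simp
  funext i
  exact key i i.2

/-- A real polynomial without real roots has constant sign. -/
theorem eval_mul_eval_pos_of_roots_eq_zero {p : ℝ[X]} (hp : p ≠ 0) (h : p.roots = 0) (x y : ℝ) :
    0 < p.eval x * p.eval y := by
  have hne : ∀ t, p.eval t ≠ 0 := fun t ht => by
    have : t ∈ p.roots := (mem_roots hp).2 ht
    simp [h] at this
  by_contra hcon
  have hmem : (0 : ℝ) ∈ Set.uIcc (p.eval x) (p.eval y) := by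
    rw [Set.mem_uIcc]
    by_contra h'
    push Not at h'
    rcases lt_or_gt_of_ne (hne x) with hx | hx
    · exact hcon (mul_pos_of_neg_of_neg hx (h'.1 hx.le))
    · exact hcon (mul_pos hx (by
        rcases lt_or_gt_of_ne (hne y) with hy | hy
        · exact absurd (h'.2 hy.le) (not_lt.2 hx.le)
        · exact hy))
  obtain ⟨t, -, ht⟩ := intermediate_value_uIcc (p.continuous.continuousOn) hmem
  exact hne t ht

/-- A system `(x ↦ x^i, x ↦ q^{-jx})` is totally positive, so the moment determinant of the
discrete Gaussian weight does not vanish. -/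
theorem det_gaussianMoment_ne_zero {q z : ℝ} (hq0 : 0 < q) (hq1 : q < 1) (hz : 0 < z) (L : ℕ) :
    (Matrix.of fun i j : Fin L =>
      gaussianMoment q (z * (q ^ (j : ℕ))⁻¹) (descPochhammer ℝ (i : ℕ))).det ≠ 0 := by
  intro hdet
  obtain ⟨v, hv, hvM⟩ := Matrix.exists_vecMul_eq_zero_iff.2 hdet
  set P : ℝ[X] := ∑ i, C (v i) * descPochhammer ℝ (i : ℕ) with hP
  have hP0 : P ≠ 0 := sum_descPochhammer_ne_zero hv
  obtain ⟨p, hprod, hcard, hroots⟩ := exists_prod_multiset_X_sub_C_mul P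
  have hp0 : p ≠ 0 := by rintro rfl; simp at hprod; exact hP0 hprod.symm
  have hL : Multiset.card P.roots < L := by
    have hdeg : P.degree < L := by
      refine (degree_sum_le _ _).trans_lt ?_
      rw [Finset.sup_lt_iff (WithBot.bot_lt_coe _)]
      intro i _
      refine degree_le_natDegree.trans_lt ?_
      have h1 := natDegree_C_mul_le (v i) (descPochhammer ℝ (i : ℕ))
      rw [descPochhammer_natDegree] at h1
      exact_mod_cast h1.trans_lt i.2
    have h1 := card_roots hP0
    exact_mod_cast h1.trans_lt hdeg
  -- In the variable `q^(-x)`, `Q` changes sign exactly where `P` does, with multiplicity.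
  set Q : ℝ[X] := (P.roots.map fun a => X - C (q ^ (-a))).prod with hQ
  have hQdeg : Q.natDegree < L := by
    have : Q = ((P.roots.map fun a => q ^ (-a)).map fun a => X - C a).prod := by
      rw [hQ, Multiset.map_map]; rfl
    rw [this, natDegree_multiset_prod_X_sub_C_eq_card, Multiset.card_map]
    exact hL
  have hzj : ∀ j : ℕ, 0 < z * (q ^ j)⁻¹ := fun j => by positivity
  -- The pairing of `P` and `Q` vanishes.
  have hcol : ∀ j : Fin L, HasSum (fun k : ℤ =>
      q ^ (k ^ 2) * P.eval (k : ℝ) * (z * (q ^ (j : ℕ))⁻¹) ^ k) 0 := by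
    intro j
    have h1 := congrFun hvM j
    have h2 : HasSum (fun k : ℤ => ∑ i : Fin L, v i *
        (q ^ (k ^ 2) * (descPochhammer ℝ (i : ℕ)).eval (k : ℝ) * (z * (q ^ (j : ℕ))⁻¹) ^ k))
        (∑ i : Fin L, v i *
          gaussianMoment q (z * (q ^ (j : ℕ))⁻¹) (descPochhammer ℝ (i : ℕ))) :=
      hasSum_sum fun i _ =>
        ((summable_gaussian_mul_eval hq0 hq1 (hzj j) _).hasSum).mul_left (v i)
    have h3 : (∑ i : Fin L, v i *
          gaussianMoment q (z * (q ^ (j : ℕ))⁻¹) (descPochhammer ℝ (i : ℕ))) = 0 := h1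
    rw [h3] at h2
    convert h2 using 2 with k
    rw [hP, eval_finsetSum, Finset.mul_sum, Finset.sum_mul]
    refine Finset.sum_congr rfl fun i _ => ?_
    rw [eval_mul, eval_C]; ring
  have hpair : HasSum (fun k : ℤ =>
      q ^ (k ^ 2) * z ^ k * (P.eval (k : ℝ) * Q.eval (q ^ (-(k : ℝ))))) 0 := by
    have h1 := hasSum_sum fun (j : Fin L) (_ : j ∈ Finset.univ) => (hcol j).mul_left (Q.coeff j)
    simp only [mul_zero, Finset.sum_const_zero] at h1
    convert! h1 using 2 with k
    rw [eval_eq_sum_range' hQdeg, ← Fin.sum_univ_eq_sum_range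
      (fun j => Q.coeff j * (q ^ (-(k : ℝ))) ^ j), Finset.mul_sum, Finset.mul_sum]
    refine Finset.sum_congr rfl fun j _ => ?_
    have : (q ^ (-(k : ℝ))) ^ (j : ℕ) = ((q ^ (j : ℕ))⁻¹) ^ k := by
      rw [Real.rpow_neg hq0.le, Real.rpow_intCast, inv_zpow, inv_pow, ← zpow_natCast,
        ← zpow_natCast, ← zpow_mul, ← zpow_mul, mul_comm]
    rw [this, mul_zpow]; ring
  have hPeval : ∀ x : ℝ, P.eval x = (P.roots.map fun a => x - a).prod * p.eval x := by
    intro x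
    conv_lhs => rw [← hprod]
    rw [eval_mul, eval_multiset_prod, Multiset.map_map]
    simp
  have hQeval : ∀ x : ℝ, Q.eval x = (P.roots.map fun a => x - q ^ (-a)).prod := by
    intro x
    rw [hQ, eval_multiset_prod, Multiset.map_map]
    simp
  have hsign : ∀ x : ℝ, 0 ≤ (P.roots.map fun a => x - a).prod *
      (P.roots.map fun a => q ^ (-x) - q ^ (-a)).prod := by
    intro x
    rw [← Multiset.prod_map_mul]
    refine Multiset.prod_nonneg fun t ht => ?_
    obtain ⟨a, -, rfl⟩ := Multiset.mem_map.1 ht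
    rcases le_total x a with hxa | hxa
    · exact mul_nonneg_of_nonpos_of_nonpos (sub_nonpos.2 hxa)
        (sub_nonpos.2 (Real.rpow_le_rpow_of_exponent_ge hq0 hq1.le (neg_le_neg hxa)))
    · exact mul_nonneg (sub_nonneg.2 hxa)
        (sub_nonneg.2 (Real.rpow_le_rpow_of_exponent_ge hq0 hq1.le (neg_le_neg hxa)))
  -- The root-free cofactor `p` has constant but unknown sign; the factor `p(0)` makes every term
  -- nonnegative.
  have hpair' := hpair.mul_left (p.eval 0)
  rw [mul_zero] at hpair'
  have hzero := (hasSum_zero_iff_of_nonneg (fun k : ℤ => ?_)).1 hpair'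
  · -- Every integer is a root of `P`.
    have hint : ∀ k : ℤ, P.eval (k : ℝ) = 0 := by
      intro k
      have h1 := congrFun hzero k
      have hp00 : p.eval 0 ≠ 0 := fun h0 => by
        have := eval_mul_eval_pos_of_roots_eq_zero hp0 hroots 0 0
        simp [h0] at this
      have hw : q ^ (k ^ 2) * z ^ k ≠ 0 := by positivity
      have h2 : P.eval (k : ℝ) * Q.eval (q ^ (-(k : ℝ))) = 0 := by
        rcases mul_eq_zero.1 h1 with h | h
        · exact absurd h hp00
        · exact (mul_eq_zero.1 h).resolve_left hw
      rcases mul_eq_zero.1 h2 with h | h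
      · exact h
      · rw [hQeval, Multiset.prod_eq_zero_iff, Multiset.mem_map] at h
        obtain ⟨a, ha, hka⟩ := h
        have h3 : -(k : ℝ) = -a :=
          (Real.strictAnti_rpow_of_base_lt_one hq0 hq1).injective (sub_eq_zero.1 hka)
        rw [neg_inj.1 h3]
        exact (mem_roots hP0).1 ha
    refine hP0 (Polynomial.eq_zero_of_infinite_isRoot P ?_)
    refine (Set.infinite_range_of_injective (Int.cast_injective (α := ℝ))).mono ?_
    rintro _ ⟨k, rfl⟩
    exact hint k
  · have h1 := (eval_mul_eval_pos_of_roots_eq_zero hp0 hroots 0 k).le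
    have h2 : (0 : ℝ) ≤ q ^ (k ^ 2) * z ^ k := by positivity
    have h3 := mul_nonneg (mul_nonneg h2 h1) (hsign k)
    rw [hPeval, hQeval]
    linarith

/-! ### `q`-Pochhammer symbols and Gaussian binomials -/

theorem qPoch_succ (q : ℝ) (n : ℕ) : qPoch q q (n + 1) = qPoch q q n * (1 - q ^ (n + 1)) := by
  rw [qPoch, Finset.prod_range_succ, ← qPoch, pow_succ']

theorem qPoch_factor_pos {q : ℝ} (hq0 : 0 < q) (hq1 : q < 1) (k : ℕ) : 0 < 1 - q * q ^ k := by
  rw [← pow_succ']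
  exact sub_pos.2 (pow_lt_one₀ hq0.le hq1 k.succ_ne_zero)

theorem qPoch_pos {q : ℝ} (hq0 : 0 < q) (hq1 : q < 1) (n : ℕ) : 0 < qPoch q q n :=
  Finset.prod_pos fun k _ => qPoch_factor_pos hq0 hq1 k

theorem qPoch_le_one {q : ℝ} (hq0 : 0 < q) (hq1 : q < 1) (n : ℕ) : qPoch q q n ≤ 1 :=
  Finset.prod_le_one (fun k _ => (qPoch_factor_pos hq0 hq1 k).le) fun k _ => by
    have : 0 < q * q ^ k := by positivity
    linarith

theorem summable_norm_neg_mul_pow {q : ℝ} (hq0 : 0 < q) (hq1 : q < 1) :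
    Summable fun k : ℕ => ‖-(q * q ^ k)‖ := by
  refine ((summable_geometric_of_lt_one hq0.le hq1).mul_left q).congr fun k => ?_
  rw [norm_neg, Real.norm_of_nonneg (by positivity)]

theorem tendsto_qPoch {q : ℝ} (hq0 : 0 < q) (hq1 : q < 1) :
    Tendsto (qPoch q q) atTop (𝓝 (qPochInf q q)) := by
  have h := (multipliable_one_add_of_summable
    (summable_norm_neg_mul_pow hq0 hq1)).tendsto_prod_tprod_nat
  simp only [← sub_eq_add_neg] at h
  exact h

theorem qPochInf_pos {q : ℝ} (hq0 : 0 < q) (hq1 : q < 1) : 0 < qPochInf q q := by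
  have h0 : 0 ≤ qPochInf q q :=
    ge_of_tendsto' (tendsto_qPoch hq0 hq1) fun n => (qPoch_pos hq0 hq1 n).le
  refine lt_of_le_of_ne h0 (Ne.symm ?_)
  have h := tprod_one_add_ne_zero_of_summable (f := fun k : ℕ => -(q * q ^ k))
    (fun k => by rw [← sub_eq_add_neg]; exact (qPoch_factor_pos hq0 hq1 k).ne')
    (summable_norm_neg_mul_pow hq0 hq1)
  simp only [← sub_eq_add_neg] at h
  exact h

theorem qPochInf_le_qPoch {q : ℝ} (hq0 : 0 < q) (hq1 : q < 1) (n : ℕ) :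
    qPochInf q q ≤ qPoch q q n := by
  refine Antitone.le_of_tendsto (antitone_nat_of_succ_le fun n => ?_) (tendsto_qPoch hq0 hq1) n
  rw [qPoch_succ]
  refine mul_le_of_le_one_right (qPoch_pos hq0 hq1 n).le ?_
  have : 0 < q ^ (n + 1) := by positivity
  linarith

/-- The Gaussian binomial coefficient, extended by zero to all integer lower indices. -/
noncomputable def gaussBinomInt (q : ℝ) (n : ℕ) (k : ℤ) : ℝ :=
  if 0 ≤ k ∧ k ≤ n then gaussBinom q n k.toNat else 0

theorem gaussBinomInt_natCast {q : ℝ} {n k : ℕ} (h : k ≤ n) :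
    gaussBinomInt q n (k : ℤ) = gaussBinom q n k := by
  rw [gaussBinomInt, if_pos ⟨by positivity, by exact_mod_cast h⟩, Int.toNat_natCast]

theorem gaussBinomInt_of_neg {q : ℝ} {n : ℕ} {k : ℤ} (h : k < 0) : gaussBinomInt q n k = 0 :=
  if_neg fun h' => by omega

theorem gaussBinomInt_of_lt {q : ℝ} {n : ℕ} {k : ℤ} (h : (n : ℤ) < k) :
    gaussBinomInt q n k = 0 :=
  if_neg fun h' => by omega

theorem gaussBinom_zero_right {q : ℝ} (hq0 : 0 < q) (hq1 : q < 1) (n : ℕ) :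
    gaussBinom q n 0 = 1 := by
  have := (qPoch_pos hq0 hq1 n).ne'
  rw [gaussBinom, Nat.sub_zero, show qPoch q q 0 = 1 by simp [qPoch], one_mul, div_self this]

theorem gaussBinom_self {q : ℝ} (hq0 : 0 < q) (hq1 : q < 1) (n : ℕ) : gaussBinom q n n = 1 := by
  have := (qPoch_pos hq0 hq1 n).ne'
  rw [gaussBinom, Nat.sub_self, show qPoch q q 0 = 1 by simp [qPoch], mul_one, div_self this]

theorem gaussBinomInt_self {q : ℝ} (hq0 : 0 < q) (hq1 : q < 1) (n : ℕ) :
    gaussBinomInt q n (n : ℤ) = 1 := by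
  rw [gaussBinomInt_natCast le_rfl, gaussBinom_self hq0 hq1]

/-- The `q`-Pascal rule. -/
theorem gaussBinomInt_succ {q : ℝ} (hq0 : 0 < q) (hq1 : q < 1) (n : ℕ) (k : ℤ) :
    gaussBinomInt q (n + 1) k =
      gaussBinomInt q n k + q ^ ((n : ℤ) + 1 - k) * gaussBinomInt q n (k - 1) := by
  rcases lt_trichotomy k 0 with hk | rfl | hk
  · rw [gaussBinomInt_of_neg hk, gaussBinomInt_of_neg hk, gaussBinomInt_of_neg (by omega)]
    ring
  · rw [gaussBinomInt_of_neg (show (0 : ℤ) - 1 < 0 by omega), mul_zero, add_zero]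
    rw [← Nat.cast_zero, gaussBinomInt_natCast (Nat.zero_le _),
      gaussBinomInt_natCast (Nat.zero_le _), gaussBinom_zero_right hq0 hq1,
      gaussBinom_zero_right hq0 hq1]
  · obtain ⟨j, rfl⟩ : ∃ j : ℕ, k = ((j + 1 : ℕ) : ℤ) := ⟨(k - 1).toNat, by omega⟩
    have hsub : (((j + 1 : ℕ) : ℤ)) - 1 = (j : ℤ) := by push_cast; ring
    rw [hsub]
    rcases lt_trichotomy j n with hj | rfl | hj
    · obtain ⟨d, rfl⟩ : ∃ d, n = j + d + 1 := ⟨n - j - 1, by omega⟩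
      rw [gaussBinomInt_natCast (by omega), gaussBinomInt_natCast (by omega),
        gaussBinomInt_natCast (by omega)]
      have he : q ^ (((j + d + 1 : ℕ) : ℤ) + 1 - ((j + 1 : ℕ) : ℤ)) = q ^ (d + 1) := by
        rw [← zpow_natCast]; congr 1; push_cast; ring
      rw [he, gaussBinom, gaussBinom, gaussBinom,
        show j + d + 1 + 1 - (j + 1) = d + 1 by omega, show j + d + 1 - (j + 1) = d by omega,
        show j + d + 1 - j = d + 1 by omega, qPoch_succ q (j + d + 1), qPoch_succ q j,
        qPoch_succ q d]
      have h1 := (qPoch_pos hq0 hq1 j).ne'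
      have h2 := (qPoch_pos hq0 hq1 d).ne'
      have h3 := (qPoch_factor_pos hq0 hq1 j).ne'
      have h4 := (qPoch_factor_pos hq0 hq1 d).ne'
      rw [← pow_succ'] at h3 h4
      field_simp
      ring
    · rw [gaussBinomInt_self hq0 hq1, gaussBinomInt_self hq0 hq1,
        gaussBinomInt_of_lt (by push_cast; omega)]
      simp
    · rw [gaussBinomInt_of_lt (by push_cast; omega), gaussBinomInt_of_lt (by push_cast; omega),
        gaussBinomInt_of_lt (by omega)]
      ring

/-- The `q`-Vandermonde convolution. -/
theorem gaussBinomInt_add {q : ℝ} (hq0 : 0 < q) (hq1 : q < 1) (n j : ℕ) (k : ℤ) :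
    gaussBinomInt q (n + j) k = ∑ l ∈ Finset.range (j + 1),
      gaussBinomInt q j l * (gaussBinomInt q n (k - l) * q ^ ((l : ℤ) * (n - k + l))) := by
  induction j generalizing k with
  | zero => simp [show gaussBinomInt q 0 0 = 1 from gaussBinomInt_self hq0 hq1 0]
  | succ j ih =>
    rw [← add_assoc, gaussBinomInt_succ hq0 hq1, ih, ih]
    -- Pascal's rule on the `j` side is matched with Pascal's rule for `n + j`; the out-of-range
    -- terms `l = j + 1` and `l = 0` drop out, so the second sum can be shifted by one.
    have h1 : ∀ l ∈ Finset.range (j + 1 + 1),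
        gaussBinomInt q (j + 1) l * (gaussBinomInt q n (k - l) * q ^ ((l : ℤ) * (n - k + l))) =
        gaussBinomInt q j l * (gaussBinomInt q n (k - l) * q ^ ((l : ℤ) * (n - k + l))) +
        q ^ ((j : ℤ) + 1 - l) * gaussBinomInt q j (l - 1) *
          (gaussBinomInt q n (k - l) * q ^ ((l : ℤ) * (n - k + l))) := fun l _ => by
      rw [gaussBinomInt_succ hq0 hq1]; ring
    rw [Finset.sum_congr rfl h1, Finset.sum_add_distrib, Finset.sum_range_succ _ (j + 1),
      gaussBinomInt_of_lt (show (j : ℤ) < ((j + 1 : ℕ) : ℤ) by push_cast; omega), zero_mul,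
      add_zero, Finset.sum_range_succ' _ (j + 1),
      gaussBinomInt_of_neg (show ((0 : ℕ) : ℤ) - 1 < 0 by simp), mul_zero, zero_mul, add_zero,
      Finset.mul_sum]
    congr 1
    refine Finset.sum_congr rfl fun l _ => ?_
    have e1 : k - 1 - (l : ℤ) = k - ((l + 1 : ℕ) : ℤ) := by push_cast; ring
    have e2 : (((l + 1 : ℕ) : ℤ)) - 1 = (l : ℤ) := by push_cast; ring
    have e3 : q ^ (((n + j : ℕ) : ℤ) + 1 - k) * q ^ ((l : ℤ) * (n - (k - 1) + l)) =
        q ^ ((j : ℤ) + 1 - ((l + 1 : ℕ) : ℤ)) *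
          q ^ (((l + 1 : ℕ) : ℤ) * (n - k + ((l + 1 : ℕ) : ℤ))) := by
      rw [← zpow_add₀ hq0.ne', ← zpow_add₀ hq0.ne']
      congr 1
      push_cast
      ring
    rw [e1, e2]
    linear_combination gaussBinomInt q j l * gaussBinomInt q n (k - ((l + 1 : ℕ) : ℤ)) * e3

theorem gaussBinomInt_nonneg {q : ℝ} (hq0 : 0 < q) (hq1 : q < 1) (n : ℕ) (k : ℤ) :
    0 ≤ gaussBinomInt q n k := by
  rw [gaussBinomInt]
  split_ifs
  · exact div_nonneg (qPoch_pos hq0 hq1 _).le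
      (mul_pos (qPoch_pos hq0 hq1 _) (qPoch_pos hq0 hq1 _)).le
  · exact le_rfl

theorem gaussBinomInt_le {q : ℝ} (hq0 : 0 < q) (hq1 : q < 1) (n : ℕ) (k : ℤ) :
    gaussBinomInt q n k ≤ 1 / (qPochInf q q * qPochInf q q) := by
  have h := qPochInf_pos hq0 hq1
  rw [gaussBinomInt]
  split_ifs
  · exact div_le_div₀ zero_le_one (qPoch_le_one hq0 hq1 n) (mul_pos h h)
      (mul_le_mul (qPochInf_le_qPoch hq0 hq1 _) (qPochInf_le_qPoch hq0 hq1 _) h.le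
        (qPoch_pos hq0 hq1 _).le)
  · positivity

/-- Central Gaussian binomial coefficients tend to `1 / (q; q)_∞`. -/
theorem tendsto_gaussBinomInt {q : ℝ} (hq0 : 0 < q) (hq1 : q < 1) (m : ℤ) :
    Tendsto (fun n : ℕ => gaussBinomInt q n (((n / 2 : ℕ) : ℤ) + m)) atTop
      (𝓝 (1 / qPochInf q q)) := by
  have h := qPochInf_pos hq0 hq1
  have hk : Tendsto (fun n : ℕ => (((n / 2 : ℕ) : ℤ) + m).toNat) atTop atTop :=
    tendsto_atTop_atTop.2 fun b => ⟨2 * (b + m.natAbs) + 2, fun n hn => by omega⟩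
  have hk' : Tendsto (fun n : ℕ => n - (((n / 2 : ℕ) : ℤ) + m).toNat) atTop atTop :=
    tendsto_atTop_atTop.2 fun b => ⟨2 * (b + m.natAbs) + 2, fun n hn => by omega⟩
  have hlim := (tendsto_qPoch hq0 hq1).div (((tendsto_qPoch hq0 hq1).comp hk).mul
    ((tendsto_qPoch hq0 hq1).comp hk')) (mul_pos h h).ne'
  have he : qPochInf q q / (qPochInf q q * qPochInf q q) = 1 / qPochInf q q := by
    field_simp
  rw [he] at hlim
  refine hlim.congr' ?_
  filter_upwards [eventually_ge_atTop (2 * m.natAbs + 2)] with n hn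
  rw [gaussBinomInt, if_pos (by omega)]
  rfl

/-! ### Falling factorials and derivatives of the polynomials -/

theorem sum_range_eq_sum_fin {L n : ℕ} (hn : n ≤ L) {f : ℕ → ℝ} (hf : ∀ k, n ≤ k → f k = 0) :
    ∑ k ∈ Finset.range n, f k = ∑ k : Fin L, f k := by
  rw [Fin.sum_univ_eq_sum_range]
  exact Finset.sum_subset (Finset.range_mono hn) fun k _ hk =>
    hf k (not_lt.1 fun h => hk (Finset.mem_range.2 h))

/-- Translates of falling factorials expand unitriangularly in falling factorials. -/
theorem exists_descPochhammer_eval_add (c : ℝ) (i : ℕ) :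
    ∃ u : ℕ → ℝ, u i = 1 ∧ (∀ k, i < k → u k = 0) ∧ ∀ x : ℝ,
      (descPochhammer ℝ i).eval (c + x) =
        ∑ k ∈ Finset.range (i + 1), u k * (descPochhammer ℝ k).eval x := by
  induction i with
  | zero =>
    refine ⟨fun k => if k = 0 then 1 else 0, by simp, fun k hk => by simp [hk.ne'], fun x => ?_⟩
    simp
  | succ i ih =>
    obtain ⟨u, hui, hu0, hu⟩ := ih
    -- The new factor is split as `c + x - i = (x - k) + (k + c - i)`; its first part raises the
    -- degree of the `k`-th falling factorial.
    refine ⟨fun k => (if k = 0 then 0 else u (k - 1)) + u k * (k + c - i), ?_, ?_, ?_⟩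
    · simp [hui, hu0 (i + 1) i.lt_succ_self]
    · intro k hk
      simp [hu0 k (by omega), hu0 (k - 1) (by omega)]
    · intro x
      simp only [add_mul, Finset.sum_add_distrib]
      rw [Finset.sum_range_succ', Finset.sum_range_succ _ (i + 1), hu0 (i + 1) i.lt_succ_self,
        descPochhammer_succ_eval, hu, Finset.sum_mul]
      simp only [if_true, zero_mul, add_zero, Nat.succ_ne_zero, if_false, Nat.add_sub_cancel]
      rw [← Finset.sum_add_distrib]
      refine Finset.sum_congr rfl fun k _ => ?_
      rw [descPochhammer_succ_eval]
      ring

/-- Pulling out `x^(-i)` keeps the full power `(-x)^n`, so the row factor is independent of `n`; for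
`n < i` the falling factorial vanishes. -/
theorem iterate_derivative_neg_X_pow_eval (n i : ℕ) {x : ℝ} (hx : x ≠ 0) :
    (derivative^[i] ((-X : ℝ[X]) ^ n)).eval x =
      (x ^ i)⁻¹ * ((descPochhammer ℝ i).eval (n : ℝ) * (-x) ^ n) := by
  have h : (-X : ℝ[X]) ^ n = C ((-1) ^ n) * X ^ n := by
    rw [neg_pow, C_pow, C_neg, C_1]
  rw [h, iterate_derivative_C_mul, iterate_derivative_X_pow_eq_C_mul, eval_mul, eval_mul, eval_C,
    eval_C, eval_pow, eval_X, descPochhammer_eval_eq_descFactorial]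
  rcases lt_or_ge n i with hni | hni
  · rw [Nat.descFactorial_of_lt hni]; simp
  · rw [neg_pow x, pow_sub₀ x hx hni]; ring

theorem iterate_derivative_stieltjesWigert_eval (q : ℝ) (n i : ℕ) {x : ℝ} (hx : x ≠ 0) :
    (derivative^[i] (stieltjesWigert q n)).eval x =
      (x ^ i)⁻¹ * ((-1) ^ n * q ^ (-(n : ℝ) ^ 2 - (n : ℝ) / 2)) *
        ∑ k ∈ Finset.range (n + 1), gaussBinom q n k * q ^ ((k : ℝ) ^ 2 + (k : ℝ) / 2) *
          ((descPochhammer ℝ i).eval (k : ℝ) * (-x) ^ k) := by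
  rw [stieltjesWigert, iterate_derivative_C_mul, iterate_derivative_sum, eval_mul, eval_C,
    eval_finsetSum, Finset.mul_sum, Finset.mul_sum]
  refine Finset.sum_congr rfl fun k _ => ?_
  rw [iterate_derivative_C_mul, eval_mul, eval_C, iterate_derivative_neg_X_pow_eval k i hx]
  ring

/-- Extension by zero gives a summation range independent of `n` and `M`, as dominated convergence
requires. -/
theorem sum_gaussBinom_eq_tsum (q : ℝ) (n : ℕ) (M : ℤ) (f : ℤ → ℝ) :
    ∑ k ∈ Finset.range (n + 1), gaussBinom q n k * f k =
      ∑' m : ℤ, gaussBinomInt q n (M + m) * f (M + m) := by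
  have h := (Equiv.addLeft M).tsum_eq fun k : ℤ => gaussBinomInt q n k * f k
  simp only [Equiv.coe_addLeft] at h
  rw [h, tsum_eq_sum (s := (Finset.range (n + 1)).map Nat.castEmbedding), Finset.sum_map]
  · refine Finset.sum_congr rfl fun k hk => ?_
    rw [Nat.castEmbedding_apply,
      gaussBinomInt_natCast (Nat.lt_succ_iff.1 (Finset.mem_range.1 hk))]
  · intro k hk
    have : ¬(0 ≤ k ∧ k ≤ n) := fun hk' => hk <| Finset.mem_map.2
      ⟨k.toNat, Finset.mem_range.2 (by omega), by rw [Nat.castEmbedding_apply]; omega⟩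
    rw [gaussBinomInt, if_neg this, zero_mul]

/-! ### The core matrix and its limit -/

/-- The finite-`N` analogue of the moment matrix of the discrete Gaussian weight. -/
noncomputable def coreMatrix (q z : ℝ) (L N : ℕ) : Matrix (Fin L) (Fin L) ℝ :=
  Matrix.of fun i l => ∑' m : ℤ,
    q ^ (m ^ 2) * (descPochhammer ℝ (i : ℕ)).eval (m : ℝ) * (z * (q ^ (l : ℕ))⁻¹) ^ m *
      gaussBinomInt q N (((N / 2 : ℕ) : ℤ) + (m - ((l : ℕ) : ℤ)))

theorem norm_gaussian_mul_gaussBinomInt_le {q : ℝ} (hq0 : 0 < q) (hq1 : q < 1) (a : ℝ) (N : ℕ)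
    (k : ℤ) : ‖a * gaussBinomInt q N k‖ ≤ ‖a‖ * (1 / (qPochInf q q * qPochInf q q)) := by
  rw [norm_mul, Real.norm_of_nonneg (gaussBinomInt_nonneg hq0 hq1 N k)]
  exact mul_le_mul_of_nonneg_left (gaussBinomInt_le hq0 hq1 N k) (norm_nonneg _)

theorem tendsto_coreMatrix {q z : ℝ} (hq0 : 0 < q) (hq1 : q < 1) (hz : 0 < z) (L : ℕ)
    (i l : Fin L) :
    Tendsto (fun N => coreMatrix q z L N i l) atTop
      (𝓝 (1 / qPochInf q q *
        gaussianMoment q (z * (q ^ (l : ℕ))⁻¹) (descPochhammer ℝ (i : ℕ)))) := by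
  have hzl : 0 < z * (q ^ (l : ℕ))⁻¹ := by positivity
  rw [mul_comm, gaussianMoment, ← tsum_mul_right]
  exact tendsto_tsum_of_dominated_convergence
    ((summable_gaussian_mul_eval hq0 hq1 hzl _).norm.mul_right
      (1 / (qPochInf q q * qPochInf q q)))
    (fun m => (tendsto_gaussBinomInt hq0 hq1 (m - ((l : ℕ) : ℤ))).const_mul _)
    (Eventually.of_forall fun N m => norm_gaussian_mul_gaussBinomInt_le hq0 hq1 _ N _)

theorem tendsto_det_coreMatrix {q z : ℝ} (hq0 : 0 < q) (hq1 : q < 1) (hz : 0 < z) (L : ℕ) :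
    Tendsto (fun N => (coreMatrix q z L N).det) atTop
      (𝓝 ((1 / qPochInf q q) ^ L * (Matrix.of fun i j : Fin L =>
        gaussianMoment q (z * (q ^ (j : ℕ))⁻¹) (descPochhammer ℝ (i : ℕ))).det)) := by
  have h : Tendsto (fun N => coreMatrix q z L N) atTop
      (𝓝 ((1 / qPochInf q q) • Matrix.of fun i j : Fin L =>
        gaussianMoment q (z * (q ^ (j : ℕ))⁻¹) (descPochhammer ℝ (i : ℕ)))) :=
    tendsto_pi_nhds.2 fun i => tendsto_pi_nhds.2 fun l => tendsto_coreMatrix hq0 hq1 hz L i l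
  have h2 := ((continuous_id.matrix_det).tendsto _).comp h
  rw [id, Matrix.det_smul, Fintype.card_fin] at h2
  exact h2

/-! ### Exact reduction of the Wronskian to the core matrix -/

theorem alpha_cast (N : ℕ) : (alpha N : ℝ) = 2 * ((N / 2 : ℕ) : ℝ) - N := by
  rw [alpha]
  generalize N / 2 = M
  push_cast
  ring

theorem alpha_eq_zero_or (N : ℕ) : alpha N = 0 ∨ alpha N = -1 := by
  rw [alpha]; omega

/-- The rescaled weight at `k = ⌊N/2⌋ + m`. -/
theorem weight_shift {q : ℝ} (hq0 : 0 < q) (L N : ℕ) (m : ℤ) :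
    q ^ (((((N / 2 : ℕ) : ℤ) + m : ℤ) : ℝ) ^ 2 + ((((N / 2 : ℕ) : ℤ) + m : ℤ) : ℝ) / 2) *
        (q ^ (-(N : ℝ) - (L : ℝ) / 2)) ^ (((N / 2 : ℕ) : ℤ) + m) =
      q ^ (((N / 2 : ℕ) : ℝ) ^ 2 - ((N / 2 : ℕ) : ℝ) * ((N : ℝ) + ((L : ℝ) - 1) / 2)) *
        (q ^ (m ^ 2) * (q ^ ((alpha N : ℝ) - ((L : ℝ) - 1) / 2)) ^ m) := by
  rw [← Real.rpow_intCast q, ← Real.rpow_intCast (q ^ _), ← Real.rpow_intCast (q ^ _),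
    ← Real.rpow_mul hq0.le, ← Real.rpow_mul hq0.le, ← Real.rpow_add hq0, ← Real.rpow_add hq0,
    ← Real.rpow_add hq0, alpha_cast]
  -- With `M = ⌊N/2⌋`, the cross terms `2Mm - Nm` combine to `α m`.
  congr 1
  generalize N / 2 = M
  push_cast
  ring

theorem summable_coreMatrix {q z : ℝ} (hq0 : 0 < q) (hq1 : q < 1) (hz : 0 < z) (P : ℝ[X]) (N : ℕ)
    (s : ℤ → ℤ) : Summable fun m : ℤ =>
      q ^ (m ^ 2) * P.eval (m : ℝ) * z ^ m * gaussBinomInt q N (s m) :=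
  ((summable_gaussian_mul_eval hq0 hq1 hz P).norm.mul_right
    (1 / (qPochInf q q * qPochInf q q))).of_norm_bounded
    fun _ => norm_gaussian_mul_gaussBinomInt_le hq0 hq1 _ N _

/-- Row and column operations reduce the sum defining a Wronskian entry to the core matrix. -/
theorem tsum_gaussBinomInt_eq_matrix_mul {q z : ℝ} (hq0 : 0 < q) (hq1 : q < 1) (hz : 0 < z)
    {L : ℕ} (N : ℕ) (i j : Fin L) {u : ℕ → ℝ} (hu0 : ∀ k, (i : ℕ) < k → u k = 0)
    (hu : ∀ x : ℝ, (descPochhammer ℝ (i : ℕ)).eval (((N / 2 : ℕ) : ℝ) + x) =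
        ∑ k ∈ Finset.range ((i : ℕ) + 1), u k * (descPochhammer ℝ k).eval x) :
    ∑' m : ℤ, gaussBinomInt q (N + (j : ℕ)) (((N / 2 : ℕ) : ℤ) + m) *
        ((descPochhammer ℝ (i : ℕ)).eval (((N / 2 : ℕ) : ℝ) + m) * (q ^ (m ^ 2) * z ^ m)) =
      ∑ l : Fin L, (∑ k : Fin L, u k * coreMatrix q z L N k l) *
        (q ^ (((l : ℕ) : ℤ) * ((N : ℤ) - ((N / 2 : ℕ) : ℤ) + ((l : ℕ) : ℤ))) *
          gaussBinomInt q (j : ℕ) ((l : ℕ) : ℤ)) := by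
  have hterm : ∀ m : ℤ, gaussBinomInt q (N + (j : ℕ)) (((N / 2 : ℕ) : ℤ) + m) *
        ((descPochhammer ℝ (i : ℕ)).eval (((N / 2 : ℕ) : ℝ) + m) * (q ^ (m ^ 2) * z ^ m)) =
      ∑ l : Fin L, (∑ k : Fin L, u k * (q ^ (m ^ 2) * (descPochhammer ℝ (k : ℕ)).eval (m : ℝ) *
          (z * (q ^ (l : ℕ))⁻¹) ^ m *
          gaussBinomInt q N (((N / 2 : ℕ) : ℤ) + (m - ((l : ℕ) : ℤ))))) *
        (q ^ (((l : ℕ) : ℤ) * ((N : ℤ) - ((N / 2 : ℕ) : ℤ) + ((l : ℕ) : ℤ))) *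
          gaussBinomInt q (j : ℕ) ((l : ℕ) : ℤ)) := by
    intro m
    rw [gaussBinomInt_add hq0 hq1, hu,
      sum_range_eq_sum_fin (L := L) i.2 fun k hk => by rw [hu0 k hk, zero_mul],
      sum_range_eq_sum_fin (L := L) j.2 fun l hl => by
        rw [gaussBinomInt_of_lt (show (((j : ℕ) : ℤ)) < (l : ℤ) by omega), zero_mul],
      Finset.sum_mul]
    refine Finset.sum_congr rfl fun l _ => ?_
    rw [Finset.sum_mul, Finset.mul_sum, Finset.sum_mul]
    refine Finset.sum_congr rfl fun k _ => ?_
    have e : q ^ (((l : ℕ) : ℤ) * ((N : ℤ) - (((N / 2 : ℕ) : ℤ) + m) + ((l : ℕ) : ℤ))) =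
        q ^ (((l : ℕ) : ℤ) * ((N : ℤ) - ((N / 2 : ℕ) : ℤ) + ((l : ℕ) : ℤ))) *
          ((q ^ (l : ℕ))⁻¹) ^ m := by
      rw [inv_zpow, ← zpow_natCast, ← zpow_mul, ← zpow_neg, ← zpow_add₀ hq0.ne']
      congr 1
      ring
    rw [e, mul_zpow, add_sub_assoc]
    ring
  rw [tsum_congr hterm]
  have hsum : ∀ l k : Fin L, Summable fun m : ℤ =>
      q ^ (m ^ 2) * (descPochhammer ℝ (k : ℕ)).eval (m : ℝ) * (z * (q ^ (l : ℕ))⁻¹) ^ m *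
          gaussBinomInt q N (((N / 2 : ℕ) : ℤ) + (m - ((l : ℕ) : ℤ))) := fun l k =>
    summable_coreMatrix hq0 hq1 (by positivity) _ N fun m => _
  exact (hasSum_sum fun l _ => (hasSum_sum fun k _ =>
    (hsum l k).hasSum.mul_left (u k)).mul_right _).tsum_eq

theorem spectralParam_ne_zero {q : ℝ} (hq0 : 0 < q) (L N : ℕ) : spectralParam q L N ≠ 0 :=
  neg_ne_zero.2 (Real.rpow_pos_of_pos hq0 _).ne'

theorem wronskianMatrix_apply_eq_tsum {q : ℝ} (hq0 : 0 < q) (L N : ℕ) (i j : Fin L) :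
    wronskianMatrix q L N i j = (spectralParam q L N ^ (i : ℕ))⁻¹ *
      ((-1) ^ (N + (j : ℕ)) *
        q ^ (-((N + (j : ℕ) : ℕ) : ℝ) ^ 2 - ((N + (j : ℕ) : ℕ) : ℝ) / 2) *
        q ^ (((N / 2 : ℕ) : ℝ) ^ 2 - ((N / 2 : ℕ) : ℝ) * ((N : ℝ) + ((L : ℝ) - 1) / 2)) *
      ∑' m : ℤ, gaussBinomInt q (N + (j : ℕ)) (((N / 2 : ℕ) : ℤ) + m) *
        ((descPochhammer ℝ (i : ℕ)).eval (((N / 2 : ℕ) : ℝ) + m) *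
          (q ^ (m ^ 2) * (q ^ ((alpha N : ℝ) - ((L : ℝ) - 1) / 2)) ^ m))) := by
  rw [wronskianMatrix, Matrix.of_apply,
    iterate_derivative_stieltjesWigert_eval q _ _ (spectralParam_ne_zero hq0 L N), mul_assoc,
    mul_assoc, mul_assoc, mul_assoc]
  congr 3
  have h := sum_gaussBinom_eq_tsum q (N + (j : ℕ)) ((N / 2 : ℕ) : ℤ) fun k =>
    (descPochhammer ℝ (i : ℕ)).eval (k : ℝ) * (q ^ ((k : ℝ) ^ 2 + (k : ℝ) / 2) *
      (q ^ (-(N : ℝ) - (L : ℝ) / 2)) ^ k)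
  simp only [weight_shift hq0] at h
  rw [spectralParam, neg_neg, ← tsum_mul_left]
  refine Eq.trans (Finset.sum_congr rfl fun k _ => ?_) (h.trans (tsum_congr fun m => ?_))
  · rw [Int.cast_natCast, zpow_natCast]; ring
  · rw [Int.cast_add, Int.cast_natCast]; ring

/-- Exact evaluation of the Wronskian up to explicit diagonal factors. -/
theorem det_wronskianMatrix {q : ℝ} (hq0 : 0 < q) (hq1 : q < 1) (L N : ℕ) :
    (wronskianMatrix q L N).det =
      (∏ j : Fin L, (spectralParam q L N ^ (j : ℕ))⁻¹ *
        ((-1) ^ (N + (j : ℕ)) *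
          q ^ (-((N + (j : ℕ) : ℕ) : ℝ) ^ 2 - ((N + (j : ℕ) : ℕ) : ℝ) / 2) *
          q ^ (((N / 2 : ℕ) : ℝ) ^ 2 - ((N / 2 : ℕ) : ℝ) * ((N : ℝ) + ((L : ℝ) - 1) / 2))) *
        q ^ (((j : ℕ) : ℤ) * ((N : ℤ) - ((N / 2 : ℕ) : ℤ) + ((j : ℕ) : ℤ)))) *
      (coreMatrix q (q ^ ((alpha N : ℝ) - ((L : ℝ) - 1) / 2)) L N).det := by
  choose u hu1 hu0 hu using fun i : Fin L =>
    exists_descPochhammer_eval_add ((N / 2 : ℕ) : ℝ) (i : ℕ)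
  set z : ℝ := q ^ ((alpha N : ℝ) - ((L : ℝ) - 1) / 2) with hz
  have hz0 : 0 < z := Real.rpow_pos_of_pos hq0 _
  set U : Matrix (Fin L) (Fin L) ℝ := Matrix.of fun i k => u i k with hU
  -- `V` is upper triangular because `[j choose l]` vanishes for `l > j`.
  set V : Matrix (Fin L) (Fin L) ℝ := Matrix.of fun l j =>
    q ^ (((l : ℕ) : ℤ) * ((N : ℤ) - ((N / 2 : ℕ) : ℤ) + ((l : ℕ) : ℤ))) *
      gaussBinomInt q (j : ℕ) ((l : ℕ) : ℤ) with hV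
  have hW : wronskianMatrix q L N = Matrix.of fun i j : Fin L =>
      (spectralParam q L N ^ (i : ℕ))⁻¹ * Matrix.of (fun i j : Fin L => ((-1) ^ (N + (j : ℕ)) *
          q ^ (-((N + (j : ℕ) : ℕ) : ℝ) ^ 2 - ((N + (j : ℕ) : ℕ) : ℝ) / 2) *
          q ^ (((N / 2 : ℕ) : ℝ) ^ 2 - ((N / 2 : ℕ) : ℝ) * ((N : ℝ) + ((L : ℝ) - 1) / 2))) *
          (U * coreMatrix q z L N * V) i j) i j := by
    ext i j
    rw [wronskianMatrix_apply_eq_tsum hq0,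
      tsum_gaussBinomInt_eq_matrix_mul hq0 hq1 hz0 N i j (hu0 i) (hu i)]
    rfl
  have hUdet : U.det = 1 := by
    rw [Matrix.det_of_isLowerTriangular U fun i k hik => hu0 i k hik]
    exact Finset.prod_eq_one fun i _ => hu1 i
  have hVdet : V.det = ∏ j : Fin L,
      q ^ (((j : ℕ) : ℤ) * ((N : ℤ) - ((N / 2 : ℕ) : ℤ) + ((j : ℕ) : ℤ))) := by
    rw [Matrix.det_of_isUpperTriangular fun l j hjl => ?_]
    · refine Finset.prod_congr rfl fun j _ => ?_
      rw [hV, Matrix.of_apply, gaussBinomInt_self hq0 hq1, mul_one]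
    · have : (j : ℕ) < (l : ℕ) := hjl
      rw [hV, Matrix.of_apply, gaussBinomInt_of_lt (by omega), mul_zero]
  rw [hW, Matrix.det_mul_column, Matrix.det_mul_row, Matrix.det_mul, Matrix.det_mul, hUdet, hVdet]
  simp only [Finset.prod_mul_distrib]
  ring

/-! ### Collecting signs and powers of `q` -/

theorem prod_neg_one_pow_mul_rpow {q : ℝ} (hq0 : 0 < q) (N : ℕ) (a b : ℝ) (L : ℕ) :
    ∏ j : Fin L, ((-1) ^ N * q ^ (a + b * ((j : ℕ) : ℝ))) =
      (-1) ^ (L * N) * q ^ ((L : ℝ) * a + b * ((L : ℝ) * ((L : ℝ) - 1) / 2)) := by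
  induction L with
  | zero => simp
  | succ L ih =>
    rw [Fin.prod_univ_castSucc]
    simp only [Fin.val_castSucc, Fin.val_last]
    rw [ih, mul_mul_mul_comm, ← pow_add, ← Real.rpow_add hq0]
    congr 2
    · ring
    · push_cast; ring

/-- The `-j²` from the monic normalization cancels the `j²` from `q`-Vandermonde, so the exponent is
affine in `j`; the sign `(-1)^j` from `λ^(-j)` cancels as well. -/
theorem diagonal_factor {q : ℝ} (hq0 : 0 < q) (L N j : ℕ) :
    (spectralParam q L N ^ j)⁻¹ *
        ((-1) ^ (N + j) * q ^ (-((N + j : ℕ) : ℝ) ^ 2 - ((N + j : ℕ) : ℝ) / 2) *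
          q ^ (((N / 2 : ℕ) : ℝ) ^ 2 - ((N / 2 : ℕ) : ℝ) * ((N : ℝ) + ((L : ℝ) - 1) / 2))) *
        q ^ ((j : ℤ) * ((N : ℤ) - ((N / 2 : ℕ) : ℤ) + (j : ℤ))) =
      (-1) ^ N * q ^ ((-(N : ℝ) ^ 2 - (N : ℝ) / 2 + ((N / 2 : ℕ) : ℝ) ^ 2 -
          ((N / 2 : ℕ) : ℝ) * ((N : ℝ) + ((L : ℝ) - 1) / 2)) +
        (-((N / 2 : ℕ) : ℝ) + ((L : ℝ) - 1) / 2) * (j : ℝ)) := by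
  have h1 : (spectralParam q L N ^ j)⁻¹ =
      (-1) ^ j * q ^ (((N : ℝ) + (L : ℝ) / 2) * (j : ℝ)) := by
    rw [spectralParam, neg_pow, mul_inv, ← inv_pow, ← inv_pow, ← Real.rpow_neg hq0.le,
      ← Real.rpow_natCast (q ^ _), ← Real.rpow_mul hq0.le]
    congr 2
    · norm_num
    · ring
  have h2 : ((-1 : ℝ) ^ j) * (-1) ^ (N + j) = (-1) ^ N := by
    rw [pow_add, mul_left_comm, ← pow_add, ← two_mul, pow_mul]; simp
  rw [h1, ← Real.rpow_intCast q, ← h2]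
  generalize N / 2 = M
  calc _ = (-1 : ℝ) ^ j * (-1) ^ (N + j) * (q ^ (((N : ℝ) + (L : ℝ) / 2) * (j : ℝ)) *
        q ^ (-((N + j : ℕ) : ℝ) ^ 2 - ((N + j : ℕ) : ℝ) / 2) *
        q ^ ((M : ℝ) ^ 2 - (M : ℝ) * ((N : ℝ) + ((L : ℝ) - 1) / 2)) *
        q ^ ((((j : ℤ) * ((N : ℤ) - (M : ℤ) + (j : ℤ)) : ℤ)) : ℝ)) := by ring
    _ = _ := by
      rw [← Real.rpow_add hq0, ← Real.rpow_add hq0, ← Real.rpow_add hq0]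
      congr 2
      push_cast
      ring

/-- `Ẑ` in terms of the determinant of the core matrix. -/
theorem rpow_mul_Zhat {q : ℝ} (hq0 : 0 < q) (hq1 : q < 1) (L N : ℕ) :
    q ^ (5 * (L : ℝ) * (N : ℝ) ^ 2 / 4 + (L : ℝ) ^ 2 * (N : ℝ) / 2) * Zhat q L N =
      q ^ ((L : ℝ) * ((L : ℝ) - (alpha N : ℝ) - 1) ^ 2 / 4) /
        (∏ j ∈ Finset.range L, (j.factorial : ℝ)) *
      (coreMatrix q (q ^ ((alpha N : ℝ) - ((L : ℝ) - 1) / 2)) L N).det := by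
  have hsign : ((-1 : ℝ) ^ (L * N)) * (-1) ^ (L * N) = 1 := by
    rw [← mul_pow]; simp
  rw [Zhat, det_wronskianMatrix hq0 hq1,
    Finset.prod_congr rfl fun (j : Fin L) _ => diagonal_factor hq0 L N (j : ℕ),
    prod_neg_one_pow_mul_rpow hq0]
  generalize (coreMatrix q (q ^ ((alpha N : ℝ) - ((L : ℝ) - 1) / 2)) L N).det = D
  have he : q ^ ((L : ℝ) * ((L : ℝ) - (alpha N : ℝ) - 1) ^ 2 / 4) =
      q ^ (5 * (L : ℝ) * (N : ℝ) ^ 2 / 4 + (L : ℝ) ^ 2 * (N : ℝ) / 2) *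
      q ^ ((L : ℝ) * (-(N : ℝ) ^ 2 - (N : ℝ) / 2 + ((N / 2 : ℕ) : ℝ) ^ 2 -
          ((N / 2 : ℕ) : ℝ) * ((N : ℝ) + ((L : ℝ) - 1) / 2)) +
        (-((N / 2 : ℕ) : ℝ) + ((L : ℝ) - 1) / 2) * ((L : ℝ) * ((L : ℝ) - 1) / 2)) := by
    rw [← Real.rpow_add hq0, alpha_cast]
    congr 1
    ring
  rw [he]
  generalize q ^ (5 * (L : ℝ) * (N : ℝ) ^ 2 / 4 + (L : ℝ) ^ 2 * (N : ℝ) / 2) = A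
  generalize q ^ ((L : ℝ) * (-(N : ℝ) ^ 2 - (N : ℝ) / 2 + ((N / 2 : ℕ) : ℝ) ^ 2 -
          ((N / 2 : ℕ) : ℝ) * ((N : ℝ) + ((L : ℝ) - 1) / 2)) +
        (-((N / 2 : ℕ) : ℝ) + ((L : ℝ) - 1) / 2) * ((L : ℝ) * ((L : ℝ) - 1) / 2)) = B
  linear_combination A * B * D / (∏ j ∈ Finset.range L, (j.factorial : ℝ)) * hsign

/-! ### The matrix `R` and the limit of the ratio -/

theorem matrixR_argument {q : ℝ} (hq0 : 0 < q) (a : ℝ) (L j : ℕ) :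
    q ^ (a - (j : ℝ) - ((L : ℝ) - 1) / 2) = q ^ (a - ((L : ℝ) - 1) / 2) * (q ^ j)⁻¹ := by
  rw [← Real.rpow_natCast, ← Real.rpow_neg hq0.le, ← Real.rpow_add hq0]
  congr 1
  ring

theorem matrixR_eq {q : ℝ} (hq0 : 0 < q) (hq1 : q < 1) (L N : ℕ) :
    matrixR q L N = Matrix.of fun i j : Fin L =>
      gaussianMoment q (q ^ ((alpha N : ℝ) - ((L : ℝ) - 1) / 2) * (q ^ (j : ℕ))⁻¹)
        (descPochhammer ℝ (i : ℕ)) := by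
  ext i j
  rw [matrixR, Matrix.of_apply, thetaD_eq_gaussianMoment hq0 hq1 (Real.rpow_pos_of_pos hq0 _),
    matrixR_argument hq0]
  rfl

theorem hasSum_matrixR {q : ℝ} (hq0 : 0 < q) (hq1 : q < 1) (L N : ℕ) (i j : Fin L) :
    HasSum
      (fun k : ℤ =>
        q ^ (k ^ 2) *
          q ^ ((k : ℝ) * ((alpha N : ℝ) - ((j : ℕ) : ℝ) - ((L : ℝ) - 1) / 2)) *
          (ascPochhammer ℝ (i : ℕ)).eval (-(k : ℝ)) * (-1) ^ (i : ℕ))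
      (matrixR q L N i j) := by
  have hz : 0 < q ^ ((alpha N : ℝ) - ((j : ℕ) : ℝ) - ((L : ℝ) - 1) / 2) :=
    Real.rpow_pos_of_pos hq0 _
  rw [matrixR, Matrix.of_apply, thetaD_eq_gaussianMoment hq0 hq1 hz, gaussianMoment]
  convert! (summable_gaussian_mul_eval hq0 hq1 hz (descPochhammer ℝ (i : ℕ))).hasSum using 2 with k
  have hsign : ((-1 : ℝ) ^ (i : ℕ)) * (-1) ^ (i : ℕ) = 1 := by
    rw [← mul_pow]; simp
  rw [ascPochhammer_eval_neg_eq_descPochhammer, ← Real.rpow_intCast (q ^ _),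
    ← Real.rpow_mul hq0.le, mul_comm (k : ℝ)]
  generalize q ^ (((alpha N : ℝ) - ((j : ℕ) : ℝ) - ((L : ℝ) - 1) / 2) * (k : ℝ)) = A
  linear_combination q ^ (k ^ 2) * A * (descPochhammer ℝ (i : ℕ)).eval (k : ℝ) * hsign

theorem tendsto_det_coreMatrix_ratio {q z : ℝ} (hq0 : 0 < q) (hq1 : q < 1) (hz : 0 < z) (L : ℕ) :
    Tendsto (fun N => (coreMatrix q z L N).det * qPochInf q q ^ L /
      (Matrix.of fun i j : Fin L =>
        gaussianMoment q (z * (q ^ (j : ℕ))⁻¹) (descPochhammer ℝ (i : ℕ))).det) atTop (𝓝 1) := by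
  have hp := (qPochInf_pos hq0 hq1).ne'
  have hdet := det_gaussianMoment_ne_zero hq0 hq1 hz L
  have h := ((tendsto_det_coreMatrix hq0 hq1 hz L).mul_const (qPochInf q q ^ L)).div_const
    (Matrix.of fun i j : Fin L =>
        gaussianMoment q (z * (q ^ (j : ℕ))⁻¹) (descPochhammer ℝ (i : ℕ))).det
  convert! h using 2
  generalize (Matrix.of fun i j : Fin L =>
    gaussianMoment q (z * (q ^ (j : ℕ))⁻¹) (descPochhammer ℝ (i : ℕ))).det = R at hdet
  rw [one_div, inv_pow]
  field_simp

theorem ratio_cancel {A F p R : ℝ} (D : ℝ) (hA : A ≠ 0) (hF : F ≠ 0) (hp : p ≠ 0) (hR : R ≠ 0) :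
    A / F * D / (A / (p * F) * R) = D * p / R := by
  field_simp

/-- Since `α` oscillates between two values, `z` has no limit; each value is treated as a constant
and the common limit is glued. -/
theorem tendsto_alpha_of_tendsto {f : ℤ → ℕ → ℝ} {l : Filter ℝ} (h0 : Tendsto (f 0) atTop l)
    (h1 : Tendsto (f (-1)) atTop l) : Tendsto (fun N => f (alpha N) N) atTop l := by
  rw [tendsto_def]
  intro s hs
  filter_upwards [h0 hs, h1 hs] with N hN0 hN1
  rcases alpha_eq_zero_or N with h | h
  · rw [Set.mem_preimage, h]; exact hN0
  · rw [Set.mem_preimage, h]; exact hN1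

theorem ratio_eq {q : ℝ} (hq0 : 0 < q) (hq1 : q < 1) (L N : ℕ) :
    (q ^ (5 * (L : ℝ) * (N : ℝ) ^ 2 / 4 + (L : ℝ) ^ 2 * (N : ℝ) / 2) * Zhat q L N) /
      (q ^ ((L : ℝ) * ((L : ℝ) - (alpha N : ℝ) - 1) ^ 2 / 4) /
        (qPochInf q q ^ L * ∏ j ∈ Finset.range L, (j.factorial : ℝ)) * (matrixR q L N).det) =
    (coreMatrix q (q ^ ((alpha N : ℝ) - ((L : ℝ) - 1) / 2)) L N).det * qPochInf q q ^ L /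
      (Matrix.of fun i j : Fin L =>
        gaussianMoment q (q ^ ((alpha N : ℝ) - ((L : ℝ) - 1) / 2) * (q ^ (j : ℕ))⁻¹)
          (descPochhammer ℝ (i : ℕ))).det := by
  rw [rpow_mul_Zhat hq0 hq1, matrixR_eq hq0 hq1]
  exact ratio_cancel _ (Real.rpow_pos_of_pos hq0 _).ne'
    (Finset.prod_ne_zero_iff.2 fun j _ => by positivity)
    (pow_ne_zero L (qPochInf_pos hq0 hq1).ne')
    (det_gaussianMoment_ne_zero hq0 hq1 (Real.rpow_pos_of_pos hq0 _) L)

end SWWronskian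

theorem theorem1 (q : ℝ) (hq0 : 0 < q) (hq1 : q < 1) (L : ℕ) :
    (∀ (N : ℕ) (i j : Fin L),
      HasSum
        (fun k : ℤ =>
          q ^ (k ^ 2) *
            q ^ ((k : ℝ) * ((SWWronskian.alpha N : ℝ) - ((j : ℕ) : ℝ) - ((L : ℝ) - 1) / 2)) *
            (ascPochhammer ℝ (i : ℕ)).eval (-(k : ℝ)) * (-1) ^ (i : ℕ))
        (SWWronskian.matrixR q L N i j)) ∧
    Tendsto
      (fun N : ℕ =>
        (q ^ (5 * (L : ℝ) * (N : ℝ) ^ 2 / 4 + (L : ℝ) ^ 2 * (N : ℝ) / 2) *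
            SWWronskian.Zhat q L N) /
          (q ^ ((L : ℝ) * ((L : ℝ) - (SWWronskian.alpha N : ℝ) - 1) ^ 2 / 4) /
              (SWWronskian.qPochInf q q ^ L * ∏ j ∈ Finset.range L, (j.factorial : ℝ)) *
            (SWWronskian.matrixR q L N).det))
      atTop (𝓝 1) := by
  refine ⟨fun N i j => SWWronskian.hasSum_matrixR hq0 hq1 L N i j, ?_⟩
  rw [tendsto_congr (SWWronskian.ratio_eq hq0 hq1 L)]
  exact SWWronskian.tendsto_alpha_of_tendsto
    (f := fun a N => (SWWronskian.coreMatrix q (q ^ ((a : ℝ) - ((L : ℝ) - 1) / 2)) L N).det *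
      SWWronskian.qPochInf q q ^ L / (Matrix.of fun i j : Fin L =>
        SWWronskian.gaussianMoment q (q ^ ((a : ℝ) - ((L : ℝ) - 1) / 2) * (q ^ (j : ℕ))⁻¹)
          (descPochhammer ℝ (i : ℕ))).det)
    (SWWronskian.tendsto_det_coreMatrix_ratio hq0 hq1 (Real.rpow_pos_of_pos hq0 _) L)
    (SWWronskian.tendsto_det_coreMatrix_ratio hq0 hq1 (Real.rpow_pos_of_pos hq0 _) L)
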